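/- Let $V$ be a finite set of $n$ vertices, let $K$ be a field of characteristic $0$, let $\lambda=(\lambda_i)_{i\in V}$ be an arbitrary family of parameters in $K$, and fix a vertex $l\in V$. For a $V\times V$ matrix $\mathbf A=(a_{ij})$ let $\mathbf A^{(\lambda)}$ be the matrix obtained from $\mathbf A$ by replacing each diagonal entry $a_{ii}$ by $\lambda_i$. For a square matrix $\mathbf M$ and $I\subseteq V$ let $\mathbf M(I|I)$ be the principal submatrix obtained by \emph{deleting} the rows and columns with index in $I$ (the determinant and permanent of the empty matrix are $1$), let $\overline I=V\setminus I$, and put $$S_l(\mathbf M)=\sum_{I\subseteq V\setminus\{l\}}(-1)^{|I|}\,\operatorname{per}\mathbf M(I|I)\,\det\mathbf M\bigl(\overline I\cup\{l\}\,\big|\,\overline I\cup\{l\}\bigr).$$ (1) Let $G$ be a simple undirected graph on $V$ with adjacency matrix $\mathbf A$, let $n\ge 3$, and let $H_c$ be the number of Hamiltonian cycles of $G$ (counted as subgraphs, i.e. without starting point and direction). Then, for every choice of $\lambda$, $$H_c=\tfrac12\,S_l\bigl(\mathbf A^{(\lambda)}\bigr).$$ For $\lambda=0$ one has $\mathbf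 A^{(0)}=\mathbf A$, and the formula reduces to the Goulden--Jackson formula $H_c=\tfrac12\,S_l(\mathbf A)$. (2) Let $D$ be a digraph on $V$ (loops allowed, no parallel arcs) with adjacency matrix $\mathbf A$, and let $n\ge 2$. Then, for every choice of $\lambda$, the number of directed Hamiltonian cycles of $D$ is $S_l(\mathbf A^{(\lambda)})$. If $D$ has no loops then $\mathbf A^{(0)}=\mathbf A$, and for $\lambda=0$ this number is $S_l(\mathbf A)$. -/

import Mathlib

/-- The set of Hamiltonian cycles of a (simple, undirected) graph. A Hamiltonian cycle is a
subgraph: the subgraph traced out by a closed walk that is a cycle through all vertices. So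
neither the starting point nor the direction in which it is traversed matters. -/
def SimpleGraph.hamiltonianCycles {V : Type*} [DecidableEq V] (G : SimpleGraph V) :
    Set G.Subgraph :=
  {H | ∃ (a : V) (p : G.Walk a a), p.IsHamiltonianCycle ∧ p.toSubgraph = H}

/-- The set of directed Hamiltonian cycles of a digraph: the cyclic sequences of vertices
(lists up to rotation) that contain every vertex exactly once and in which there is an arc from
each vertex to the next one, and from the last vertex back to the first one. -/
def Digraph.hamiltonianCycles {V : Type*} (D : Digraph V) : Set (Cycle V) :=
  {c | c.Nodup ∧ (∀ v : V, v ∈ c) ∧ c.Chain D.Adj}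

/-- The adjacency matrix of a digraph. -/
def Digraph.adjMatrix {V : Type*} (K : Type*) [Zero K] [One K] (D : Digraph V)
    [DecidableRel D.Adj] : Matrix V V K :=
  Matrix.of fun i j => if D.Adj i j then 1 else 0

namespace Matrix

/-- The matrix `A^(lam)`: the diagonal entries of `A` are replaced by `lam i`, the other entries
are kept. -/
def replaceDiag {V K : Type*} [DecidableEq V] (A : Matrix V V K) (lam : V → K) : Matrix V V K :=
  Matrix.of fun i j => if i = j then lam i else A i j

/-- The principal submatrix `M(I|I)`, obtained from `M` by deleting the rows and the columns with
index in `I`. If `I` is everything then this is the empty matrix, whose determinant and permanent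
are `1`. -/
def deletePrincipal {V K : Type*} (M : Matrix V V K) (I : Finset V) :
    Matrix {i : V // i ∉ I} {i : V // i ∉ I} K :=
  M.submatrix Subtype.val Subtype.val

/-- The sum over all `I ⊆ V ∖ {l}` of `(-1)^|I| · per M(I|I) · det M(Iᶜ ∪ {l} | Iᶜ ∪ {l})`. -/
def perDetSum {V K : Type*} [Fintype V] [DecidableEq V] [CommRing K]
    (M : Matrix V V K) (l : V) : K :=
  ∑ I ∈ (Finset.univ.erase l).powerset,
    (-1) ^ I.card * (M.deletePrincipal I).permanent * (M.deletePrincipal (insert l Iᶜ)).det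

end Matrix

/-! Expand permanent and determinant. Since `l ∉ I`, the `I`-term runs over permutations preserving
`I`, each weighted by `(-1)^|I|` times the sign of its restriction to `I`. After swapping the sums,
the coefficient of `σ` is a sum over unions of cycles avoiding `l`. A cycle of length `k`
contributes `(-1)^k (-1)^(k-1) = -1`, so each such cycle gives a factor `1 - 1`, and only full
cycles survive (`sum_signOn`). Full cycles have no fixed points, so the diagonal never enters: hence
the freedom in `lam`. They are the directed Hamiltonian cycles; for `n ≥ 3` an undirected one comes
from exactly two, `σ` and `σ⁻¹`. -/

namespace Equiv.Perm

/-! ### Signed sum over the invariant sets of a permutation -/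

variable {V : Type*} [Fintype V] [DecidableEq V]

/-- A permutation is a full cycle if it is a single cycle moving every point. -/
def IsFullCycle (σ : Perm V) : Prop := σ.IsCycle ∧ ∀ x, σ x ≠ x

/-- The signed weight `(-1)^|I| · sign (σ|I)` of an invariant set `I`, and `0` if `I` is not
invariant. -/
def signOn (σ : Perm V) (I : Finset V) : ℤ :=
  if h : ∀ x, σ x ∈ I ↔ x ∈ I then (-1) ^ I.card * (sign (σ.subtypePerm h) : ℤ) else 0

theorem signOn_empty (σ : Perm V) : σ.signOn ∅ = 1 := by
  rw [signOn, dif_pos (by simp), Subsingleton.elim (σ.subtypePerm _) 1]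
  simp

omit [Fintype V] in
theorem ofSubtype_subtypePerm_apply (σ : Perm V) {I : Finset V} (h : ∀ x, σ x ∈ I ↔ x ∈ I)
    (x : V) : ofSubtype (σ.subtypePerm h) x = if x ∈ I then σ x else x := by
  split_ifs with hx
  · rw [ofSubtype_apply_of_mem _ hx]; rfl
  · rw [ofSubtype_apply_of_not_mem _ hx]

theorem signOn_union (σ : Perm V) {I C : Finset V} (hI : ∀ x, σ x ∈ I ↔ x ∈ I)
    (hC : ∀ x, σ x ∈ C ↔ x ∈ C) (hd : _root_.Disjoint I C) :
    σ.signOn (I ∪ C) = σ.signOn I * σ.signOn C := by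
  have hU : ∀ x, σ x ∈ I ∪ C ↔ x ∈ I ∪ C := fun x => by simp [hI, hC]
  have key : ofSubtype (σ.subtypePerm hU) =
      ofSubtype (σ.subtypePerm hI) * ofSubtype (σ.subtypePerm hC) := by
    ext x
    simp only [mul_apply, ofSubtype_subtypePerm_apply]
    by_cases hx : x ∈ C
    · have := (Finset.disjoint_right.1 hd) ((hC x).2 hx)
      simp [hx, this]
    · simp [hx]
  rw [signOn, signOn, signOn, dif_pos hU, dif_pos hI, dif_pos hC, Finset.card_union_of_disjoint hd,
    ← sign_ofSubtype (σ.subtypePerm hU), key, map_mul, sign_ofSubtype, sign_ofSubtype]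
  push_cast
  ring

theorem mem_orbit_iff (σ : Perm V) (a x : V) :
    σ x ∈ Finset.univ.filter (σ.SameCycle a) ↔ x ∈ Finset.univ.filter (σ.SameCycle a) := by
  simp

theorem signOn_orbit (σ : Perm V) (a : V) :
    σ.signOn (Finset.univ.filter (σ.SameCycle a)) = -1 := by
  have key : ofSubtype (σ.subtypePerm (σ.mem_orbit_iff a)) = σ.cycleOf a := by
    ext x
    rw [ofSubtype_subtypePerm_apply, cycleOf_apply]
    simp
  rw [signOn, dif_pos (σ.mem_orbit_iff a), ← sign_ofSubtype, key]
  by_cases ha : σ a = a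
  · have : Finset.univ.filter (σ.SameCycle a) = {a} := by
      ext x
      simp only [Finset.mem_filter, Finset.mem_univ, true_and, Finset.mem_singleton]
      constructor
      · rintro ⟨k, rfl⟩
        exact zpow_apply_eq_self_of_apply_eq_self ha k
      · rintro rfl; rfl
    rw [this, (cycleOf_eq_one_iff σ).2 ha]
    simp
  · have : (σ.cycleOf a).support = Finset.univ.filter (σ.SameCycle a) := by
      ext x
      rw [mem_support_cycleOf_iff' ha]
      simp
    rw [(isCycle_cycleOf σ ha).sign, this]
    push_cast
    rw [mul_neg, ← mul_pow]
    simp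

/-- On one point the identity also has sum `1` without being a full cycle, hence `Nontrivial V`. -/
theorem sum_signOn [Nontrivial V] (σ : Perm V) [Decidable σ.IsFullCycle] (l : V) :
    ∑ I ∈ (Finset.univ.erase l).powerset, σ.signOn I = if σ.IsFullCycle then 1 else 0 := by
  have hmem (I : Finset V) : I ∈ (Finset.univ.erase l).powerset ↔ l ∉ I := by
    rw [Finset.mem_powerset]
    constructor
    · intro h hl
      simpa using h hl
    · intro h x hx
      simp only [Finset.mem_erase, Finset.mem_univ, and_true]
      rintro rfl; exact h hx
  have hinv {I : Finset V} (h : ∀ x, σ x ∈ I ↔ x ∈ I) {x y : V} (hxy : σ.SameCycle x y) :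
      x ∈ I ↔ y ∈ I := by
    obtain ⟨k, rfl⟩ := hxy
    induction k using Int.induction_on with
    | zero => simp
    | succ k ih => rw [ih, add_comm, zpow_add, zpow_one, mul_apply, h]
    | pred k ih => rw [ih, sub_eq_neg_add, zpow_add, zpow_neg_one, mul_apply,
        ← h (σ⁻¹ _), ← mul_apply, mul_inv_cancel, one_apply]
  split_ifs with hσ
  · rw [Finset.sum_eq_single ∅, signOn_empty]
    · intro I hI hne
      rw [signOn, dif_neg]
      intro h
      obtain ⟨x, hx⟩ := Finset.nonempty_iff_ne_empty.2 hne
      exact (hmem I).1 hI ((hinv h (hσ.1.sameCycle (hσ.2 x) (hσ.2 l))).1 hx)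
    · simp
  · obtain ⟨a, ha⟩ : ∃ a, ¬ σ.SameCycle a l := by
      by_contra! hall
      have hfix (x : V) : σ x ≠ x := by
        intro hx
        obtain ⟨y, hy⟩ := exists_ne x
        obtain ⟨k, hk⟩ := (hall x).trans (hall y).symm
        rw [zpow_apply_eq_self_of_apply_eq_self hx] at hk
        exact hy hk.symm
      exact hσ ⟨⟨l, hfix l, fun y _ => (hall y).symm⟩, hfix⟩
    set C := Finset.univ.filter (σ.SameCycle a) with hC
    have hCinv := σ.mem_orbit_iff a
    rw [← hC] at hCinv
    have haC : a ∈ C := by simp [hC, SameCycle.refl]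
    have hlC : l ∉ C := by simpa [hC] using ha
    have hsub {I : Finset V} (h : ∀ x, σ x ∈ I ↔ x ∈ I) (haI : a ∈ I) : C ⊆ I := by
      intro x hx
      exact (hinv h (by simpa [hC] using hx)).1 haI
    have hdis {I : Finset V} (h : ∀ x, σ x ∈ I ↔ x ∈ I) (haI : a ∉ I) : _root_.Disjoint I C := by
      rw [Finset.disjoint_right]
      intro x hx hxI
      exact haI ((hinv h (by simpa [hC] using hx)).2 hxI)
    have hsymm {I : Finset V} (h : ∀ x, σ x ∈ I ↔ x ∈ I) (x : V) :
        σ x ∈ symmDiff I C ↔ x ∈ symmDiff I C := by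
      simp [Finset.mem_symmDiff, h, hCinv]
    have hneg {I : Finset V} (h : ∀ x, σ x ∈ I ↔ x ∈ I) (haI : a ∉ I) :
        σ.signOn (symmDiff I C) = -σ.signOn I := by
      rw [(hdis h haI).symmDiff_eq_sup, Finset.sup_eq_union, signOn_union σ h hCinv (hdis h haI),
        signOn_orbit, mul_neg_one]
    -- Toggling the cycle `C`, which avoids `l`, pairs the sets `I` with opposite weights.
    refine Finset.sum_involution (fun I _ => symmDiff I C) ?_ ?_ ?_ ?_
    · intro I _
      by_cases h : ∀ x, σ x ∈ I ↔ x ∈ I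
      · by_cases haI : a ∈ I
        · have := hneg (hsymm h) (by simp [Finset.mem_symmDiff, haI, haC])
          rw [symmDiff_symmDiff_cancel_right] at this
          rw [this]; ring
        · rw [hneg h haI]; ring
      · have h' : ¬ ∀ x, σ x ∈ symmDiff I C ↔ x ∈ symmDiff I C := by
          intro h'
          have := hsymm h'
          rw [symmDiff_symmDiff_cancel_right] at this
          exact h this
        rw [signOn, signOn, dif_neg h, dif_neg h', add_zero]
    · intro I _ _ heq
      have : a ∈ symmDiff I C ↔ a ∈ I := by rw [heq]
      simp [Finset.mem_symmDiff, haC] at this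
    · intro I hI
      rw [hmem] at hI ⊢
      simp [Finset.mem_symmDiff, hI, hlC]
    · intro I _
      exact symmDiff_symmDiff_cancel_right _ _

end Equiv.Perm

/-! ### Expansion of the permanent-determinant sum -/

namespace Matrix

open Equiv Equiv.Perm

variable {V K : Type*} [Fintype V] [DecidableEq V] [CommRing K]

/-- A permutation preserving `I` is a pair of permutations of `Iᶜ` and `I`; all others have weight
`0`. -/
theorem permanent_mul_det_submatrix (M : Matrix V V K) (I : Finset V) :
    (-1) ^ I.card * (M.submatrix Subtype.val Subtype.val :
        Matrix {i // i ∉ I} {i // i ∉ I} K).permanent *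
      (M.submatrix Subtype.val Subtype.val : Matrix {i // i ∈ I} {i // i ∈ I} K).det =
    ∑ σ : Perm V, (σ.signOn I : K) * ∏ i, M (σ i) i := by
  rw [permanent, det_apply', mul_assoc, Finset.sum_mul_sum, ← Finset.sum_product', Finset.mul_sum]
  rw [← Finset.sum_filter_of_ne (p := fun σ : Perm V => ∀ x, σ x ∈ I ↔ x ∈ I)]
  · symm
    refine Finset.sum_bij'
      (fun σ hσ => (σ.subtypePerm (p := (· ∉ I)) fun x => not_congr ((Finset.mem_filter.1 hσ).2 x),
        σ.subtypePerm (p := (· ∈ I)) (Finset.mem_filter.1 hσ).2))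
      (fun τ _ => Perm.subtypeCongr τ.2 τ.1) ?_ ?_ ?_ ?_ ?_
    · simp
    · rintro ⟨τ, ρ⟩ _
      simp only [Finset.mem_filter, Finset.mem_univ, true_and]
      intro x
      by_cases hx : x ∈ I
      · simp [Perm.subtypeCongr.left_apply, hx]
      · simp only [Perm.subtypeCongr.right_apply _ _ hx, hx, iff_false]
        exact (τ ⟨x, hx⟩).2
    · intro σ hσ
      ext x
      by_cases hx : x ∈ I
      · simp [Perm.subtypeCongr.left_apply, hx]
      · simp [Perm.subtypeCongr.right_apply _ _ hx]
    · rintro ⟨τ, ρ⟩ _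
      ext x
      · simp [Perm.subtypeCongr.right_apply _ _ x.2]
      · simp [Perm.subtypeCongr.left_apply _ _ x.2]
    · intro σ hσ
      rw [signOn, dif_pos (Finset.mem_filter.1 hσ).2,
        ← Fintype.prod_subtype_mul_prod_subtype (fun i => i ∈ I) (fun i => M (σ i) i)]
      simp only [submatrix_apply, subtypePerm_apply]
      push_cast
      rw [mul_assoc, ← mul_assoc (Int.cast _), mul_comm (Int.cast _ * _)]
      congr!
  · intro σ _ h
    by_contra hσ
    rw [signOn, dif_neg hσ] at h
    simp at h

open scoped Classical in
theorem perDetSum_eq_sum_isFullCycle [Nontrivial V] (M : Matrix V V K) (l : V) :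
    M.perDetSum l = ∑ σ : Perm V with σ.IsFullCycle, ∏ i, M i (σ i) := by
  have hterm : ∀ I ∈ (Finset.univ.erase l).powerset,
      (-1) ^ I.card * (M.deletePrincipal I).permanent * (M.deletePrincipal (insert l Iᶜ)).det =
        ∑ σ : Perm V, (σ.signOn I : K) * ∏ i, M (σ i) i := by
    intro I hI
    have hl : l ∉ I := fun h => by simpa using Finset.mem_powerset.1 hI h
    rw [← permanent_mul_det_submatrix]
    congr 1
    have hiff (i : V) : i ∈ I ↔ i ∉ insert l Iᶜ := by
      rw [Finset.insert_eq_of_mem (by simpa using hl)]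
      simp
    rw [← det_submatrix_equiv_self (Equiv.subtypeEquivRight hiff)]
    rfl
  rw [perDetSum, Finset.sum_congr rfl hterm, Finset.sum_comm]
  simp_rw [← Finset.sum_mul, ← Int.cast_sum, sum_signOn]
  -- Inversion turns the factors `M (σ i) i` into `M i (σ i)`.
  rw [← Equiv.sum_comp (Equiv.inv (Perm V)), Finset.sum_filter]
  refine Finset.sum_congr rfl fun σ _ => ?_
  have hiff : (Equiv.inv (Perm V) σ).IsFullCycle ↔ σ.IsFullCycle := by
    simp only [IsFullCycle, Equiv.inv_apply, isCycle_inv, ne_eq, inv_eq_iff_eq]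
    simp only [eq_comm]
  simp only [hiff]
  split_ifs
  · rw [← Equiv.prod_comp σ]
    simp
  · simp

end Matrix

/-! ### Full cycles and Hamiltonian cycles of digraphs -/

namespace Equiv.Perm

variable {V : Type*}

theorem IsFullCycle.sameCycle {σ : Perm V} (h : σ.IsFullCycle) (x y : V) : σ.SameCycle x y :=
  h.1.sameCycle (h.2 x) (h.2 y)

theorem IsFullCycle.inv {σ : Perm V} (h : σ.IsFullCycle) : σ⁻¹.IsFullCycle :=
  ⟨h.1.inv, fun x hx => h.2 x (inv_eq_iff_eq.1 hx).symm⟩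

theorem IsFullCycle.apply_apply_ne [Fintype V] {σ : Perm V} (h : σ.IsFullCycle)
    (hV : 3 ≤ Fintype.card V) (x : V) : σ (σ x) ≠ x := by
  classical
  intro hx
  have h1 : σ ^ 2 = 1 := h.1.pow_eq_one_iff.2 ⟨x, h.2 x, by rw [pow_two, mul_apply, hx]⟩
  have h2 := orderOf_dvd_of_pow_eq_one h1
  have h3 : σ.support = Finset.univ := by
    ext y; simp [h.2 y]
  rw [h.1.orderOf, h3, Finset.card_univ] at h2
  have := Nat.le_of_dvd two_pos h2
  omega

/-- Follow the `σ`-orbit of `a`: if `τ` first turned back after a step along `σ`, then `τ` would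
have a 2-cycle, impossible for `n ≥ 3`. -/
theorem IsFullCycle.eq_of_forall [Fintype V] {σ τ : Perm V} (hσ : σ.IsFullCycle)
    (hτ : τ.IsFullCycle) (hV : 3 ≤ Fintype.card V) (h : ∀ x, τ x = σ x ∨ τ x = σ⁻¹ x) {a : V}
    (ha : τ a = σ a) : τ = σ := by
  ext x
  obtain ⟨n, rfl⟩ := (hσ.sameCycle a x).exists_nat_pow_eq
  induction n with
  | zero => simpa using ha
  | succ n ih =>
    rw [pow_succ', mul_apply]
    refine (h _).resolve_right fun h' => hτ.apply_apply_ne hV ((σ ^ n) a) ?_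
    rw [ih, h']
    exact σ.symm_apply_apply _

theorem IsFullCycle.eq_or_eq_inv [Fintype V] {σ τ : Perm V} (hσ : σ.IsFullCycle)
    (hτ : τ.IsFullCycle) (hV : 3 ≤ Fintype.card V) (h : ∀ x, τ x = σ x ∨ τ x = σ⁻¹ x) :
    τ = σ ∨ τ = σ⁻¹ := by
  obtain ⟨a, -⟩ := hσ.1
  rcases h a with ha | ha
  · exact .inl (hσ.eq_of_forall hτ hV h ha)
  · exact .inr (hσ.inv.eq_of_forall hτ hV (fun x => by simpa using (h x).symm) ha)

end Equiv.Perm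

theorem List.isFullCycle_formPerm {V : Type*} [DecidableEq V] [Nontrivial V] {l : List V}
    (hl : l.Nodup) (hmem : ∀ v, v ∈ l) : l.formPerm.IsFullCycle := by
  have h2 : 2 ≤ l.length := by
    obtain ⟨x, y, hxy⟩ := exists_pair_ne V
    by_contra! h
    match l, hmem with
    | [], hmem => simpa using hmem x
    | [z], hmem => exact hxy ((List.mem_singleton.1 (hmem x)).trans
        (List.mem_singleton.1 (hmem y)).symm)
    | _ :: _ :: _, _ => simp at h
  exact ⟨isCycle_formPerm hl h2, fun x => (formPerm_apply_mem_ne_self_iff _ hl _ (hmem x)).2 h2⟩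

theorem List.chain_coe_iff_forall_formPerm {V : Type*} [DecidableEq V] {r : V → V → Prop}
    {l : List V} (hl : l.Nodup) (hmem : ∀ v, v ∈ l) :
    (l : Cycle V).Chain r ↔ ∀ x, r x (l.formPerm x) := by
  rcases l with _ | ⟨a, t⟩
  · exact ⟨fun _ x => by simpa using hmem x, fun _ => Cycle.Chain.nil r⟩
  rw [Cycle.chain_coe_cons, isChain_iff_getElem]
  have hlast (i : ℕ) (hi : i < (a :: t).length) :
      (a :: (t ++ [a]))[i]'(by simp at hi ⊢; omega) = (a :: t)[i] := by
    simp only [← List.cons_append]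
    rw [List.getElem_append_left hi]
  -- Includes the wrap-around from the last entry to the appended `a`.
  have hnext (i : ℕ) (hi : i < (a :: t).length) :
      (a :: (t ++ [a]))[i + 1]'(by simp at hi ⊢; omega) = (a :: t).formPerm (a :: t)[i] := by
    rw [formPerm_apply_getElem _ hl]
    rcases Nat.lt_or_ge (i + 1) (a :: t).length with h | h
    · rw [hlast _ h]
      simp only [Nat.mod_eq_of_lt h]
    · have : i + 1 = (a :: t).length := by omega
      simp only [this, Nat.mod_self]
      simp
  constructor
  · intro h x
    obtain ⟨i, hi, rfl⟩ := getElem_of_mem (hmem x)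
    rw [← hnext i hi, ← hlast i hi]
    exact h i _
  · intro h i hi
    have hi' : i < (a :: t).length := by simp at hi ⊢; omega
    rw [hlast i hi', hnext i hi']
    exact h _

theorem Equiv.Perm.IsFullCycle.exists_list {V : Type*} [Fintype V] [DecidableEq V]
    {σ : Equiv.Perm V} (hσ : σ.IsFullCycle) :
    ∃ l : List V, l.Nodup ∧ (∀ v, v ∈ l) ∧ l.formPerm = σ := by
  obtain ⟨a, -⟩ := hσ.1
  refine ⟨σ.toList a, nodup_toList _ _, fun v => ?_, ?_⟩
  · rw [mem_toList_iff]
    exact ⟨hσ.sameCycle a v, by simpa using hσ.2 a⟩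
  · rw [formPerm_toList, hσ.1.cycleOf_eq (hσ.2 a)]

open Equiv.Perm in
theorem Digraph.ncard_hamiltonianCycles {V : Type*} [Fintype V] [DecidableEq V] [Nontrivial V]
    (D : Digraph V) :
    D.hamiltonianCycles.ncard =
      {σ : Equiv.Perm V | σ.IsFullCycle ∧ ∀ x, D.Adj x (σ x)}.ncard := by
  refine Set.ncard_congr (fun c hc => c.formPerm hc.1) ?_ ?_ ?_
  · intro c
    induction c using Quotient.inductionOn' with
    | h l =>
      rintro ⟨h1, h2, h3⟩
      exact ⟨List.isFullCycle_formPerm h1 h2, (List.chain_coe_iff_forall_formPerm h1 h2).1 h3⟩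
  · intro c d hc hd h
    refine (Cycle.formPerm_eq_formPerm_iff.1 h).resolve_right fun h' => ?_
    obtain ⟨x, y, hxy⟩ := exists_pair_ne V
    exact hxy (h'.1.congr (hc.2.1 x) (hc.2.1 y))
  · rintro σ ⟨h1, h2⟩
    obtain ⟨l, hl, hmem, rfl⟩ := h1.exists_list
    exact ⟨(l : Cycle V), ⟨hl, hmem, (List.chain_coe_iff_forall_formPerm hl hmem).2 h2⟩, rfl⟩

open scoped Classical in
theorem Matrix.perDetSum_zero_one {V K : Type*} [Fintype V] [DecidableEq V] [Nontrivial V]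
    [CommRing K] (r : V → V → Prop) (M : Matrix V V K)
    (hM : ∀ i j, i ≠ j → M i j = if r i j then 1 else 0) (l : V) :
    M.perDetSum l = ({σ : Equiv.Perm V | σ.IsFullCycle ∧ ∀ x, r x (σ x)}.ncard : K) := by
  rw [perDetSum_eq_sum_isFullCycle, Set.ncard_eq_toFinset_card', Set.toFinset_ofPred,
    ← Finset.filter_filter, Finset.card_filter, Nat.cast_sum]
  refine Finset.sum_congr rfl fun σ hσ => ?_
  rw [Finset.prod_congr rfl fun i _ => hM i (σ i) ((Finset.mem_filter.1 hσ).2.2 i).symm,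
    Finset.prod_ite_zero]
  simp

/-! ### Undirected Hamiltonian cycles -/

namespace SimpleGraph

variable {V : Type*} {G : SimpleGraph V}

/-- The spanning subgraph whose edges are the pairs `x, σ x`. -/
def permSubgraph (G : SimpleGraph V) (σ : Equiv.Perm V) : G.Subgraph where
  verts := Set.univ
  Adj x y := G.Adj x y ∧ (σ x = y ∨ σ y = x)
  adj_sub h := h.1
  edge_vert _ := Set.mem_univ _
  symm := ⟨fun _ _ h => ⟨h.1.symm, h.2.symm⟩⟩

variable [DecidableEq V]

theorem Walk.apply_getVert_of_nodup {a : V} (p : G.Walk a a) (hp : p.support.tail.Nodup)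
    {i : ℕ} (hi : i < p.length) :
    p.support.tail.formPerm (p.getVert i) = p.getVert (i + 1) := by
  have hlen : p.support.tail.length = p.length := by simp
  have hget (j : ℕ) (hj : j < p.length) :
      p.support.tail[j]'(by omega) = p.getVert (j + 1) := by
    rw [List.getElem_tail, support_getElem_eq_getVert]
  rcases i with _ | i
  -- The tail drops the starting vertex, which recurs as its last entry.
  · have h0 : p.getVert 0 = p.getVert (p.length - 1 + 1) := by
      rw [Nat.sub_add_cancel hi]; simp
    rw [h0, ← hget (p.length - 1) (by omega), List.formPerm_apply_getElem _ hp]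
    have : (p.length - 1 + 1) % p.support.tail.length = 0 := by
      rw [hlen, Nat.sub_add_cancel hi, Nat.mod_self]
    simp only [this]
    rw [hget 0 hi]
  · rw [← hget i (by omega), List.formPerm_apply_getElem _ hp]
    have : (i + 1) % p.support.tail.length = i + 1 := Nat.mod_eq_of_lt (by omega)
    simp only [this]
    rw [hget (i + 1) hi]

theorem Walk.forall_adj_formPerm {a : V} (p : G.Walk a a) (hp : p.support.tail.Nodup)
    (hmem : ∀ v, v ∈ p.support.tail) (x : V) :
    p.toSubgraph.Adj x (p.support.tail.formPerm x) := by
  obtain ⟨i, hi, rfl⟩ : ∃ i < p.length, p.getVert i = x := by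
    obtain ⟨i, hix, hi⟩ := mem_support_iff_exists_getVert.1 (List.mem_of_mem_tail (hmem x))
    rcases hi.lt_or_eq with h | rfl
    · exact ⟨i, h, hix⟩
    · have : 0 < p.length := by
        have := List.length_pos_of_mem (hmem x)
        simpa using this
      exact ⟨0, this, by rw [← hix]; simp⟩
  rw [p.apply_getVert_of_nodup hp hi]
  exact p.toSubgraph_adj_getVert hi

theorem Walk.toSubgraph_eq_permSubgraph {a : V} (p : G.Walk a a) (hp : p.support.tail.Nodup)
    (hmem : ∀ v, v ∈ p.support.tail) :
    p.toSubgraph = G.permSubgraph p.support.tail.formPerm := by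
  refine Subgraph.ext ?_ ?_
  · ext v
    simp [permSubgraph, List.mem_of_mem_tail (hmem v)]
  · ext x y
    constructor
    · intro h
      refine ⟨h.adj_sub, ?_⟩
      obtain ⟨i, hxy, hi⟩ := p.toSubgraph_adj_iff.1 h
      have := p.apply_getVert_of_nodup hp hi
      rcases Sym2.eq_iff.1 hxy with ⟨rfl, rfl⟩ | ⟨rfl, rfl⟩
      · exact .inl this
      · exact .inr this
    · rintro ⟨-, rfl | rfl⟩
      · exact p.forall_adj_formPerm hp hmem _
      · exact (p.forall_adj_formPerm hp hmem _).symm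

theorem hamiltonianCycles_eq_image [Fintype V] (hV : 3 ≤ Fintype.card V) :
    G.hamiltonianCycles = G.permSubgraph '' {σ | σ.IsFullCycle ∧ ∀ x, G.Adj x (σ x)} := by
  have : Nontrivial V := Fintype.one_lt_card_iff_nontrivial.1 (by omega)
  ext H
  constructor
  · rintro ⟨a, p, hp, rfl⟩
    obtain ⟨hc, hcount⟩ :=
      Walk.isHamiltonianCycle_iff_isCycle_and_support_count_tail_eq_one.1 hp
    have hmem (v : V) : v ∈ p.support.tail := List.count_pos_iff.1 (by rw [hcount v]; exact one_pos)
    exact ⟨p.support.tail.formPerm, ⟨List.isFullCycle_formPerm hc.support_nodup hmem,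
      fun x => (p.forall_adj_formPerm hc.support_nodup hmem x).adj_sub⟩,
      (p.toSubgraph_eq_permSubgraph hc.support_nodup hmem).symm⟩
  · rintro ⟨σ, ⟨hσ, hadj⟩, rfl⟩
    obtain ⟨l, hl, hmem, rfl⟩ := hσ.exists_list
    have hchain := (List.chain_coe_iff_forall_formPerm hl hmem).2 hadj
    rcases l with _ | ⟨a, t⟩
    · obtain ⟨v, -⟩ := hσ.1
      simpa using hmem v
    rw [Cycle.chain_coe_cons] at hchain
    have hrot : (a :: t).IsRotated (t ++ [a]) := ⟨1, by simp⟩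
    obtain ⟨p, hp⟩ : ∃ p : G.Walk a a, p.support = a :: (t ++ [a]) :=
      ⟨(Walk.ofSupport _ (List.cons_ne_nil _ _) hchain).copy rfl (by simp),
        (Walk.support_copy ..).trans (Walk.support_ofSupport ..)⟩
    have htail : p.support.tail = t ++ [a] := by rw [hp]; rfl
    have hnd : p.support.tail.Nodup := by rw [htail]; exact hrot.nodup_iff.1 hl
    have hm (v : V) : v ∈ p.support.tail := by rw [htail]; exact hrot.mem_iff.1 (hmem v)
    have hlen : p.length = Fintype.card V := by
      have h1 : p.support.tail.length = p.length := by simp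
      have h2 : p.support.tail.toFinset = Finset.univ := by ext v; simpa using hm v
      rw [← h1, ← List.toFinset_card_of_nodup hnd, h2, Finset.card_univ]
    have hnil : ¬ p.Nil := by rw [Walk.not_nil_iff_lt_length]; omega
    refine ⟨a, p, Walk.isHamiltonianCycle_iff_isCycle_and_support_count_tail_eq_one.2
      ⟨Walk.isCycle_iff_isPath_tail_and_le_length.2 ⟨?_, by omega⟩, fun v =>
        List.count_eq_one_of_mem hnd (hm v)⟩, ?_⟩
    · refine Walk.IsPath.mk' ?_
      rwa [Walk.support_tail_of_not_nil p hnil]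
    · rw [p.toSubgraph_eq_permSubgraph hnd hm, htail, List.formPerm_eq_of_isRotated hl hrot]

omit [DecidableEq V] in
theorem permSubgraph_inv (σ : Equiv.Perm V) : G.permSubgraph σ⁻¹ = G.permSubgraph σ := by
  refine Subgraph.ext rfl ?_
  ext x y
  simp only [permSubgraph, Equiv.Perm.inv_eq_iff_eq]
  constructor <;> rintro ⟨h, h' | h'⟩ <;>
    exact ⟨h, by simp [h']⟩

/-- The fibres of `permSubgraph` over Hamiltonian cycles are the pairs `{σ, σ⁻¹}`. -/
theorem two_mul_ncard_hamiltonianCycles [Fintype V] (hV : 3 ≤ Fintype.card V) :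
    2 * G.hamiltonianCycles.ncard =
      {σ : Equiv.Perm V | σ.IsFullCycle ∧ ∀ x, G.Adj x (σ x)}.ncard := by
  classical
  rw [hamiltonianCycles_eq_image hV, Set.ncard_eq_toFinset_card', Set.ncard_eq_toFinset_card',
    Set.toFinset_image, mul_comm, Finset.card_eq_sum_card_image G.permSubgraph
      (Set.toFinset {σ : Equiv.Perm V | σ.IsFullCycle ∧ ∀ x, G.Adj x (σ x)})]
  refine (Finset.sum_const_nat fun H hH => ?_).symm
  obtain ⟨σ, hσ, rfl⟩ := Finset.mem_image.1 hH
  obtain ⟨hσ, hadj⟩ := Set.mem_toFinset.1 hσ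
  have hne : σ ≠ σ⁻¹ := by
    intro h
    obtain ⟨a, -⟩ := hσ.1
    refine hσ.apply_apply_ne hV a ?_
    nth_rw 1 [h]
    exact σ.symm_apply_apply a
  rw [← Finset.card_pair hne]
  congr 1
  ext τ
  simp only [Finset.mem_filter, Set.mem_toFinset, Set.mem_ofPred_eq, Finset.mem_insert,
    Finset.mem_singleton]
  constructor
  · rintro ⟨⟨hτ, hτadj⟩, heq⟩
    refine hσ.eq_or_eq_inv hτ hV fun x => ?_
    have h1 : (G.permSubgraph τ).Adj x (τ x) := ⟨hτadj x, .inl rfl⟩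
    rw [heq] at h1
    exact h1.2.imp Eq.symm fun h => Equiv.Perm.eq_inv_iff_eq.2 h
  · rintro (rfl | rfl)
    · exact ⟨⟨hσ, hadj⟩, rfl⟩
    · refine ⟨⟨hσ.inv, fun x => ?_⟩, permSubgraph_inv σ⟩
      have := (hadj (σ⁻¹ x)).symm
      rwa [show σ (σ⁻¹ x) = x from σ.apply_symm_apply x] at this

end SimpleGraph

theorem mainTheorem2 {V : Type*} [Fintype V] [DecidableEq V] {K : Type*} [Field K] [CharZero K]
    (l : V) :
    -- undirected graphs
    (∀ (G : SimpleGraph V) [DecidableRel G.Adj], 3 ≤ Fintype.card V →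
      (∀ lam : V → K, (G.hamiltonianCycles.ncard : K) =
        1 / 2 * ((G.adjMatrix K).replaceDiag lam).perDetSum l) ∧
      -- the case `lam = 0`
      ((G.adjMatrix K).replaceDiag 0 = G.adjMatrix K ∧
        (G.hamiltonianCycles.ncard : K) = 1 / 2 * (G.adjMatrix K).perDetSum l)) ∧
    -- digraphs
    (∀ (D : Digraph V) [DecidableRel D.Adj], 2 ≤ Fintype.card V →
      (∀ lam : V → K, (D.hamiltonianCycles.ncard : K) =
        ((D.adjMatrix K).replaceDiag lam).perDetSum l) ∧
      -- the case `lam = 0`, for digraphs without loops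
      ((∀ v, ¬ D.Adj v v) → (D.adjMatrix K).replaceDiag 0 = D.adjMatrix K ∧
        (D.hamiltonianCycles.ncard : K) = (D.adjMatrix K).perDetSum l)) := by
  constructor
  · intro G _ hV
    have : Nontrivial V := Fintype.one_lt_card_iff_nontrivial.1 (by omega)
    have key (lam : V → K) : (G.hamiltonianCycles.ncard : K) =
        1 / 2 * ((G.adjMatrix K).replaceDiag lam).perDetSum l := by
      rw [Matrix.perDetSum_zero_one G.Adj, ← SimpleGraph.two_mul_ncard_hamiltonianCycles hV]
      · push_cast; ring
      · intro i j hij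
        simp [Matrix.replaceDiag, hij, SimpleGraph.adjMatrix_apply]
    have h0 : (G.adjMatrix K).replaceDiag 0 = G.adjMatrix K := by
      ext i j
      by_cases h : i = j
      · subst h; simp [Matrix.replaceDiag]
      · simp [Matrix.replaceDiag, h]
    exact ⟨key, h0, by simpa only [h0] using key 0⟩
  · intro D _ hV
    have : Nontrivial V := Fintype.one_lt_card_iff_nontrivial.1 (by omega)
    have key (lam : V → K) : (D.hamiltonianCycles.ncard : K) =
        ((D.adjMatrix K).replaceDiag lam).perDetSum l := by
      rw [Matrix.perDetSum_zero_one D.Adj, D.ncard_hamiltonianCycles]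
      intro i j hij
      simp [Matrix.replaceDiag, hij, Digraph.adjMatrix]
    refine ⟨key, fun hD => ?_⟩
    have h0 : (D.adjMatrix K).replaceDiag 0 = D.adjMatrix K := by
      ext i j
      by_cases h : i = j
      · subst h; simp [Matrix.replaceDiag, Digraph.adjMatrix, hD]
      · simp [Matrix.replaceDiag, h]
    exact ⟨h0, by simpa only [h0] using key 0⟩
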